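/- Let $m$ be a prime and let $\mathcal A_m$ be the group of automorphisms of the one-rooted regular $m$-ary tree, whose vertices are the finite words over $Y=\{1,\dots,m\}$. Write $g=(g_1,\dots,g_m)p$ for the automorphism $yu\mapsto p(y)\,g_y(u)$ ($p$ a permutation of $Y$, $g_y\in\mathcal A_m$); the states $g_u$ of $g$ at words $u$ are given by $g(uw)=g(u)\,g_u(w)$. Let $\sigma$ be the $m$-cycle $(1,2,\dots,m)$, also regarded as the tree automorphism $(e,\dots,e)\sigma$, and let $x$ denote the diagonal map $g\mapsto g^{x}=(g,\dots,g)$. For a subgroup $G\le\mathcal A_m$ let $\overline G$ be its closure in the topology in which the level stabilizers $\mathrm{Stab}(n)$ are a basis of neighbourhoods of $e$, and let $G^{*}$ be the closure of the subgroup generated by all $g^{x^i}$ with $g\in G$, $i\ge 0$. For $j\ge 1$ let $\alpha=(e,\dots,e,\alpha^{x^{j-1}})\sigma$ be the generalized adding machine and let $D_m(j)$ be the group generated by its states. Let $A\le\mathcal A_m$ be an abelian subgroup that is transitive (it acts transitively on $Y$) and state-closed (it contains all states of its elements). (1) If $A$ has a nontrivial element of finite order, then $A^{*}$ is a torsion group,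 $A$ and $A^{*}$ have exponent $m$, and $A^{*}$ is conjugate in $\mathcal A_m$ to $\langle\sigma\rangle^{*}$. Moreover there is a group isomorphism from the additive group of $(\mathbb Z/m\mathbb Z)[[x]]$ onto $\langle\sigma\rangle^{*}$ that takes $1$ to $\sigma$ and multiplication by $x$ to the diagonal map. (2) If $A$ is torsion-free, then $A^{*}$ is torsion-free; $A^{*}=\langle\beta\rangle^{*}$ for every $\beta\in A\setminus\mathrm{Stab}_A(1)$; $A^{*}$ is topologically finitely generated; and $A^{*}$ is conjugate in $\mathcal A_m$ to $\overline{D_m(j)}$ for some $j\ge 1$. -/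

import Mathlib

/-! Automorphisms of the one-rooted regular `m`-ary tree. The vertices are the finite words over
the alphabet `Fin m` (that is, `List (Fin m)`, with root `[]`), ordered by the prefix relation.
Automorphisms are composed as functions; writing actions on the right instead replaces the group by
its opposite, which has the same subgroups, conjugacy classes of subgroups and closures. -/

/-- The automorphism group of the `m`-ary rooted tree: the permutations of the set of words that
preserve and reflect the prefix order. -/
def treeAutSubgroup (m : ℕ) : Subgroup (Equiv.Perm (List (Fin m))) where
  carrier := {g | ∀ u v : List (Fin m), g u <+: g v ↔ u <+: v}
  one_mem' := fun _ _ => Iff.rfl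
  mul_mem' := fun {a b} ha hb u v => (ha (b u) (b v)).trans (hb u v)
  inv_mem' := fun {a} ha u v => by
    have h := ha (a⁻¹ u) (a⁻¹ v)
    simpa using h.symm

/-- The group of automorphisms of the `m`-ary rooted tree. -/
abbrev TreeAut (m : ℕ) : Type := treeAutSubgroup m

namespace TreeAut

variable {m : ℕ}

/-- The action of a tree automorphism on vertices. -/
def act (g : TreeAut m) (w : List (Fin m)) : List (Fin m) := g.1 w

theorem act_prefix (g : TreeAut m) (u v : List (Fin m)) :
    g.act u <+: g.act v ↔ u <+: v := g.2 u v

theorem act_inv_act (g : TreeAut m) (w : List (Fin m)) : g⁻¹.act (g.act w) = w := by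
  simp [act]

theorem act_act_inv (g : TreeAut m) (w : List (Fin m)) : g.act (g⁻¹.act w) = w := by
  simp [act]

theorem ext_act {g h : TreeAut m} (H : ∀ w, g.act w = h.act w) : g = h :=
  Subtype.ext (Equiv.ext H)

theorem le_length_act (g : TreeAut m) (w : List (Fin m)) : w.length ≤ (g.act w).length := by
  induction w using List.reverseRecOn with
  | nil => simp
  | append_singleton u y ih =>
    have hp : g.act u <+: g.act (u ++ [y]) := (g.act_prefix _ _).2 (List.prefix_append _ _)
    have hne : (g.act u).length ≠ (g.act (u ++ [y])).length := fun h => by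
      have h1 := g.1.injective (hp.eq_of_length h)
      simpa using congrArg List.length h1
    have := hp.length_le
    simp only [List.length_append, List.length_singleton]
    omega

theorem length_act (g : TreeAut m) (w : List (Fin m)) : (g.act w).length = w.length := by
  refine le_antisymm ?_ (g.le_length_act w)
  have := le_length_act g⁻¹ (g.act w)
  rwa [act_inv_act] at this

theorem act_append (g : TreeAut m) (u w : List (Fin m)) :
    g.act (u ++ w) = g.act u ++ (g.act (u ++ w)).drop u.length := by
  obtain ⟨t, ht⟩ := (g.act_prefix u (u ++ w)).2 (List.prefix_append _ _)
  rw [← ht, ← g.length_act u, List.drop_left]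

theorem act_inv_append (g : TreeAut m) (u w : List (Fin m)) :
    g⁻¹.act (g.act u ++ w) = u ++ (g⁻¹.act (g.act u ++ w)).drop u.length := by
  have h := act_append g⁻¹ (g.act u) w
  rwa [act_inv_act, length_act] at h

/-- The state `g_u` of `g` at the vertex `u`, defined by `g (u w) = g (u) g_u (w)`. -/
def state (u : List (Fin m)) (g : TreeAut m) : TreeAut m :=
  ⟨{ toFun := fun w => (g.act (u ++ w)).drop u.length
     invFun := fun w => (g⁻¹.act (g.act u ++ w)).drop u.length
     left_inv := fun w => by
       change (g⁻¹.act (g.act u ++ (g.act (u ++ w)).drop u.length)).drop u.length = w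
       rw [← act_append, act_inv_act, List.drop_left]
     right_inv := fun w => by
       change (g.act (u ++ (g⁻¹.act (g.act u ++ w)).drop u.length)).drop u.length = w
       rw [← act_inv_append, act_act_inv, ← g.length_act u, List.drop_left] },
   fun v w => by
     change (g.act (u ++ v)).drop u.length <+: (g.act (u ++ w)).drop u.length ↔ v <+: w
     rw [← List.prefix_append_right_inj (g.act u), ← act_append, ← act_append, act_prefix,
       List.prefix_append_right_inj]⟩

theorem act_append_state (g : TreeAut m) (u w : List (Fin m)) :
    g.act (u ++ w) = g.act u ++ (g.state u).act w := g.act_append u w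

/-- The function underlying `(f_1, ..., f_m) p`. -/
def nodeFun (p : Equiv.Perm (Fin m)) (f : Fin m → TreeAut m) : List (Fin m) → List (Fin m)
  | [] => []
  | y :: u => p y :: (f y).act u

/-- The inverse function of `nodeFun p f`. -/
def nodeInv (p : Equiv.Perm (Fin m)) (f : Fin m → TreeAut m) : List (Fin m) → List (Fin m)
  | [] => []
  | y :: u => p.symm y :: (f (p.symm y))⁻¹.act u

/-- The tree automorphism `(f_1, ..., f_m) p`, mapping `y u` to `p(y) f_y(u)`. -/
def node (p : Equiv.Perm (Fin m)) (f : Fin m → TreeAut m) : TreeAut m :=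
  ⟨{ toFun := nodeFun p f
     invFun := nodeInv p f
     left_inv := fun w => by cases w <;> simp [nodeFun, nodeInv, act_inv_act]
     right_inv := fun w => by cases w <;> simp [nodeFun, nodeInv, act_act_inv] },
   fun v w => by
     change nodeFun p f v <+: nodeFun p f w ↔ v <+: w
     cases v with
     | nil => simp [nodeFun]
     | cons y v =>
       cases w with
       | nil => simp [nodeFun]
       | cons z w =>
         simp only [nodeFun, List.cons_prefix_cons, EmbeddingLike.apply_eq_iff_eq]
         refine and_congr_right fun h => ?_
         subst h
         exact act_prefix _ _ _⟩

/-- The extension of a permutation of the alphabet to the tree: it acts on the first letter. -/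
def rooted (p : Equiv.Perm (Fin m)) : TreeAut m := node p fun _ => 1

/-- The diagonal map `g ↦ (g, ..., g)`, denoted by `x`. -/
def diag (g : TreeAut m) : TreeAut m := node 1 fun _ => g

/-- The automorphism of the tree induced by the `m`-cycle `σ = (1, 2, ..., m)`. -/
def sigma (m : ℕ) : TreeAut m := rooted (finRotate m)

/-- The stabilizer of the `n`-th level of the tree. -/
def levelStab (m n : ℕ) : Subgroup (TreeAut m) where
  carrier := {g | ∀ w : List (Fin m), w.length = n → g.act w = w}
  one_mem' := fun _ _ => rfl
  mul_mem' := fun {a b} ha hb w hw => by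
    change a.act (b.act w) = w
    rw [hb w hw, ha w hw]
  inv_mem' := fun {a} ha w hw => by
    have h := a.act_inv_act w
    rwa [ha w hw] at h

/-- The closure of a subgroup in the topology of the tree, in which the level stabilizers are a
basis of neighbourhoods of the identity: `g` is in the closure if and only if it agrees on every
level with some element of the subgroup. -/
def treeClosure (G : Subgroup (TreeAut m)) : Subgroup (TreeAut m) where
  carrier := {g | ∀ n : ℕ, ∃ k ∈ G, ∀ w : List (Fin m), w.length = n → g.act w = k.act w}
  one_mem' := fun _ => ⟨1, G.one_mem, fun _ _ => rfl⟩
  mul_mem' := fun {a b} ha hb n => by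
    obtain ⟨k, hk, hak⟩ := ha n
    obtain ⟨l, hl, hbl⟩ := hb n
    refine ⟨k * l, G.mul_mem hk hl, fun w hw => ?_⟩
    change a.act (b.act w) = k.act (l.act w)
    rw [hak _ ((b.length_act w).trans hw), hbl w hw]
  inv_mem' := fun {a} ha n => by
    obtain ⟨k, hk, hak⟩ := ha n
    refine ⟨k⁻¹, G.inv_mem hk, fun w hw => ?_⟩
    have h := hak (k⁻¹.act w) ((length_act k⁻¹ w).trans hw)
    rw [act_act_inv] at h
    rw [← h, act_inv_act, h]

/-- The diagonal closure: the subgroup generated by all `g^(i)`, `g ∈ G`, `i ≥ 0`. -/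
def diagClosure (G : Subgroup (TreeAut m)) : Subgroup (TreeAut m) :=
  Subgroup.closure {g | ∃ i : ℕ, ∃ a ∈ G, g = diag^[i] a}

/-- The diagonal-topological closure `G*`. -/
def star (G : Subgroup (TreeAut m)) : Subgroup (TreeAut m) := treeClosure (diagClosure G)

/-- `G` is state-closed (self-similar): it contains all states of its elements. -/
def StateClosed (G : Subgroup (TreeAut m)) : Prop :=
  ∀ g ∈ G, ∀ u : List (Fin m), g.state u ∈ G

/-- `G` is transitive: it permutes the alphabet (the first level) transitively. -/
def Transitive (G : Subgroup (TreeAut m)) : Prop :=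
  ∀ y z : Fin m, ∃ g ∈ G, g.act [y] = [z]

/-- Two subgroups are conjugate by a tree automorphism. -/
def Conj (G H : Subgroup (TreeAut m)) : Prop :=
  ∃ h : TreeAut m, G.map (MulAut.conj h).toMonoidHom = H

/-- `G` is topologically finitely generated (as a closed subgroup): some finitely generated
subgroup of `G` is dense in it. -/
def TopologicallyFG (G : Subgroup (TreeAut m)) : Prop :=
  ∃ S : Finset (TreeAut m), treeClosure (Subgroup.closure (S : Set (TreeAut m))) = G

/-- The map on words given by `α^(k)`, where `α = (e, ..., e, α^(j-1)) σ`: it keeps `k` letters,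
then applies `σ` to the next letter, and if that letter was the last one of the alphabet it goes on
with `α^(j-1)` on the remaining word. -/
def addFun (j : ℕ) : ℕ → List (Fin m) → List (Fin m)
  | _, [] => []
  | k + 1, y :: u => y :: addFun j k u
  | 0, y :: u => finRotate m y :: (if (y : ℕ) + 1 = m then addFun j (j - 1) u else u)

/-- The inverse map of `addFun j k`. -/
def addInv (j : ℕ) : ℕ → List (Fin m) → List (Fin m)
  | _, [] => []
  | k + 1, y :: u => y :: addInv j k u
  | 0, y :: u => (finRotate m).symm y ::
      (if (((finRotate m).symm y : Fin m) : ℕ) + 1 = m then addInv j (j - 1) u else u)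

theorem addInv_addFun (j : ℕ) (w : List (Fin m)) : ∀ k, addInv j k (addFun j k w) = w := by
  induction w with
  | nil => intro k; cases k <;> rfl
  | cons y u ih =>
    intro k
    cases k with
    | succ k => simp [addFun, addInv, ih]
    | zero =>
      by_cases h : (y : ℕ) + 1 = m <;>
        simp only [addFun, addInv, Equiv.symm_apply_apply, h, if_true, if_false, ih]

theorem addFun_addInv (j : ℕ) (w : List (Fin m)) : ∀ k, addFun j k (addInv j k w) = w := by
  induction w with
  | nil => intro k; cases k <;> rfl
  | cons y u ih =>
    intro k
    cases k with
    | succ k => simp [addFun, addInv, ih]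
    | zero =>
      by_cases h : (((finRotate m).symm y : Fin m) : ℕ) + 1 = m <;>
        simp only [addFun, addInv, Equiv.apply_symm_apply, h, if_true, if_false, ih]

theorem addFun_prefix (j : ℕ) (v : List (Fin m)) :
    ∀ (k : ℕ) (w : List (Fin m)), addFun j k v <+: addFun j k w ↔ v <+: w := by
  induction v with
  | nil => intro k w; cases k <;> simp [addFun]
  | cons y v ih =>
    intro k w
    cases w with
    | nil => cases k <;> simp [addFun]
    | cons z w =>
      cases k with
      | succ k => simp [addFun, List.cons_prefix_cons, ih]
      | zero =>
        simp only [addFun, List.cons_prefix_cons, EmbeddingLike.apply_eq_iff_eq]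
        refine and_congr_right fun h => ?_
        subst h
        split_ifs
        · exact ih _ _
        · exact Iff.rfl

/-- The automorphism given by `addFun j k`. -/
def addAut (m j k : ℕ) : TreeAut m :=
  ⟨{ toFun := addFun j k
     invFun := addInv j k
     left_inv := fun w => addInv_addFun j w k
     right_inv := fun w => addFun_addInv j w k },
   fun v w => addFun_prefix j v k w⟩

/-- The generalized adding machine `α = (e, ..., e, α^(j-1)) σ`, for `j ≥ 1`. -/
def addingMachine (m j : ℕ) : TreeAut m := addAut m j 0

theorem addAut_eq_diag (m j k : ℕ) : addAut m j k = diag^[k] (addingMachine m j) := by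
  induction k with
  | zero => rfl
  | succ k ih =>
    rw [Function.iterate_succ_apply', ← ih]
    exact ext_act fun w => by cases w <;> rfl

/-- The defining equation `α = (e, ..., e, α^(j-1)) σ` of the generalized adding machine. -/
theorem addingMachine_eq (m j : ℕ) :
    addingMachine m j = node (finRotate m)
      fun y => if (y : ℕ) + 1 = m then diag^[j - 1] (addingMachine m j) else 1 := by
  rw [← addAut_eq_diag]
  refine ext_act fun w => ?_
  cases w with
  | nil => rfl
  | cons y u =>
    change finRotate m y :: (if (y : ℕ) + 1 = m then addFun j (j - 1) u else u) =
      finRotate m y :: act (if (y : ℕ) + 1 = m then addAut m j (j - 1) else 1) u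
    by_cases h : (y : ℕ) + 1 = m
    · rw [if_pos h, if_pos h]; rfl
    · rw [if_neg h, if_neg h]; rfl

/-- `D_m(j)`, the group generated by the states of the generalized adding machine. -/
def groupD (m j : ℕ) : Subgroup (TreeAut m) :=
  Subgroup.closure {s | ∃ u : List (Fin m), s = (addingMachine m j).state u}

end TreeAut

/-!
The group `B = A*` is again abelian, transitive and state-closed, and moreover invariant under the
diagonal map `x` and closed (`isSaturated_star`); everything is proved for such *saturated* groups.

As `B` is abelian and transitive, the states of an element of `B` that fixes the first level are all
equal, so that `B ∩ Stab(n)` is `B^(x^n)` (`IsSaturated.exists_diag_iterate_eq`). On the first level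
`B` acts as a regular group of prime order `m`. Hence each quotient of the filtration
`B ∩ Stab(n)` has order `m` and is generated by any element of depth `n`, where the depth of an
element is the last level that it fixes. A subgroup with an element of every depth is therefore
dense (`IsSaturated.treeClosure_eq_of_depth`); the elements `β^(x^n)`, with `β` outside `Stab(1)`,
give `B = ⟨β⟩*`. The same filtration shows that if `β ^ m` has depth `j`, then `m`-th powers increase
all depths by exactly `j` (`IsSaturated.pow_depth`), whence `B` is torsion-free, and that `B` has
exponent `m` if `β ^ m = 1`.

For the conjugacy, take in each of two saturated groups a sequence with one term of each depth:
`β^(x^k)` if the exponent is `m`, and `(β^(x^(k % j))) ^ (m ^ (k / j))` in the torsion-free case.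
The `m`-th power of the `k`-th term is `1` or the `(k + j)`-th term, in both groups alike, so that
the correspondence of the two sequences extends to dense subgroups and preserves depths. As both
groups act regularly on each level, it is induced by a tree automorphism
(`IsSaturated.conj_of_depth`). The groups compared with `B` are `⟨σ⟩*` and the closure of `D_m(j)`.
The latter is saturated because `D_m(j)` is abelian and generated by all the `α^(x^k)`, which holds
because `α ^ m = α^(x^j)`. Finally `⟨σ⟩*` consists of the automorphisms that rotate the letters of a
word independently of each other, by the coefficients of a power series.
-/

namespace TreeAut

variable {m : ℕ}

/-! ### Action, states and the diagonal map -/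

@[simp] theorem act_one (w : List (Fin m)) : (1 : TreeAut m).act w = w := rfl

theorem act_mul (g h : TreeAut m) (w : List (Fin m)) : (g * h).act w = g.act (h.act w) := rfl

@[simp] theorem act_nil (g : TreeAut m) : g.act [] = [] :=
  List.length_eq_zero_iff.1 (g.length_act [])

@[simp] theorem act_diag_cons (g : TreeAut m) (y : Fin m) (u : List (Fin m)) :
    (diag g).act (y :: u) = y :: g.act u := rfl

theorem act_cons (g : TreeAut m) (y : Fin m) (u : List (Fin m)) :
    g.act (y :: u) = g.act [y] ++ (g.state [y]).act u := g.act_append_state [y] u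

/-- The diagonal map as a group homomorphism. -/
def diagHom (m : ℕ) : TreeAut m →* TreeAut m where
  toFun := diag
  map_one' := ext_act fun w => by cases w <;> rfl
  map_mul' g h := ext_act fun w => by cases w <;> rfl

/-- The iterates of the diagonal map as group homomorphisms. -/
def diagIterHom (m : ℕ) (n : ℕ) : TreeAut m →* TreeAut m where
  toFun := diag^[n]
  map_one' := Function.iterate_fixed (map_one (diagHom m)) n
  map_mul' := iterate_map_mul (diagHom m) n

theorem diag_iterate_mul (n : ℕ) (g h : TreeAut m) :
    diag^[n] (g * h) = diag^[n] g * diag^[n] h := map_mul (diagIterHom m n) g h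

theorem diag_iterate_inv (n : ℕ) (g : TreeAut m) : diag^[n] g⁻¹ = (diag^[n] g)⁻¹ :=
  map_inv (diagIterHom m n) g

theorem diag_iterate_pow (n k : ℕ) (g : TreeAut m) : diag^[n] (g ^ k) = (diag^[n] g) ^ k :=
  map_pow (diagIterHom m n) g k

theorem diag_iterate_zpow (n : ℕ) (k : ℤ) (g : TreeAut m) :
    diag^[n] (g ^ k) = (diag^[n] g) ^ k := map_zpow (diagIterHom m n) g k

theorem state_nil (g : TreeAut m) : g.state [] = g := ext_act fun _ => rfl

theorem state_append (g : TreeAut m) (u v : List (Fin m)) :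
    g.state (u ++ v) = (g.state u).state v := ext_act fun w => by
  have h := g.act_append_state (u ++ v) w
  rw [List.append_assoc, act_append_state, act_append_state, act_append_state g u v,
    List.append_assoc] at h
  exact (List.append_cancel_left (List.append_cancel_left h)).symm

theorem state_cons (g : TreeAut m) (y : Fin m) (u : List (Fin m)) :
    g.state (y :: u) = (g.state [y]).state u := g.state_append [y] u

theorem state_mul (g h : TreeAut m) (u : List (Fin m)) :
    (g * h).state u = g.state (h.act u) * h.state u := ext_act fun w => by
  have H := (g * h).act_append_state u w
  rw [act_mul, act_append_state, act_append_state, act_mul] at H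
  exact (List.append_cancel_left H).symm

@[simp] theorem state_one (u : List (Fin m)) : (1 : TreeAut m).state u = 1 := by
  simpa using state_mul 1 1 u

theorem state_inv (g : TreeAut m) (u : List (Fin m)) :
    g⁻¹.state u = (g.state (g⁻¹.act u))⁻¹ := by
  rw [eq_inv_iff_mul_eq_one.trans mul_eq_one_comm, ← state_mul, mul_inv_cancel, state_one]

@[simp] theorem state_diag (g : TreeAut m) (y : Fin m) : (diag g).state [y] = g :=
  ext_act fun _ => rfl

/-! ### Level stabilizers and closures -/

theorem mem_levelStab_zero (g : TreeAut m) : g ∈ levelStab m 0 := fun w hw => by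
  rw [List.length_eq_zero_iff.1 hw, act_nil]

theorem inv_mul_mem_levelStab {g k : TreeAut m} {n : ℕ} :
    k⁻¹ * g ∈ levelStab m n ↔ ∀ w : List (Fin m), w.length = n → g.act w = k.act w := by
  refine forall₂_congr fun w _ => ?_
  rw [act_mul]
  constructor
  · intro h
    rw [← act_act_inv k (g.act w), h]
  · intro h
    rw [h, act_inv_act]

theorem mem_treeClosure {G : Subgroup (TreeAut m)} {g : TreeAut m} :
    g ∈ treeClosure G ↔ ∀ n, ∃ k ∈ G, k⁻¹ * g ∈ levelStab m n := by
  simp_rw [inv_mul_mem_levelStab]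
  rfl

instance levelStab_normal (m n : ℕ) : (levelStab m n).Normal where
  conj_mem g hg h w hw := by
    rw [act_mul, act_mul, hg _ ((length_act _ _).trans hw), act_act_inv]

theorem levelStab_antitone (hm : 0 < m) : Antitone (levelStab m) :=
  antitone_nat_of_succ_le fun n g hg w hw => by
    have h := hg (w ++ [⟨0, hm⟩]) (by simp [hw])
    rw [act_append_state] at h
    exact (List.append_inj h (g.length_act w)).1

@[simp] theorem diag_mem_levelStab_succ (hm : 0 < m) {g : TreeAut m} {n : ℕ} :
    diag g ∈ levelStab m (n + 1) ↔ g ∈ levelStab m n := by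
  constructor
  · intro h w hw
    have := h (⟨0, hm⟩ :: w) (by simp [hw])
    simpa using this
  · rintro h (_ | ⟨y, w⟩) hw
    · simp at hw
    · rw [act_diag_cons, h w (by simpa using hw)]

theorem diag_iterate_mem_levelStab (hm : 0 < m) {g : TreeAut m} (k n : ℕ) :
    diag^[k] g ∈ levelStab m (k + n) ↔ g ∈ levelStab m n := by
  induction k with
  | zero => simp
  | succ k ih =>
    rw [Function.iterate_succ_apply', show k + 1 + n = k + n + 1 by omega,
      diag_mem_levelStab_succ hm, ih]

theorem eq_one_of_forall_mem_levelStab {g : TreeAut m} (h : ∀ n, g ∈ levelStab m n) : g = 1 :=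
  ext_act fun w => h w.length w rfl

/-- The depth of a nontrivial automorphism: the last level that it fixes. -/
theorem exists_mem_levelStab_notMem_succ {g : TreeAut m} (h : g ≠ 1) :
    ∃ n, g ∈ levelStab m n ∧ g ∉ levelStab m (n + 1) := by
  by_contra! H
  exact h (eq_one_of_forall_mem_levelStab fun n => Nat.rec (mem_levelStab_zero g) H n)

theorem le_treeClosure (G : Subgroup (TreeAut m)) : G ≤ treeClosure G :=
  fun g hg _ => ⟨g, hg, fun _ _ => rfl⟩

theorem treeClosure_mono {G H : Subgroup (TreeAut m)} (h : G ≤ H) :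
    treeClosure G ≤ treeClosure H := fun _ hg n =>
  let ⟨k, hk, hgk⟩ := hg n
  ⟨k, h hk, hgk⟩

theorem treeClosure_idem (G : Subgroup (TreeAut m)) :
    treeClosure (treeClosure G) = treeClosure G :=
  le_antisymm (fun g hg n => by
    obtain ⟨k, hk, hgk⟩ := hg n
    obtain ⟨l, hl, hkl⟩ := hk n
    exact ⟨l, hl, fun w hw => (hgk w hw).trans (hkl w hw)⟩) (le_treeClosure _)

theorem map_conj_treeClosure_le (G : Subgroup (TreeAut m)) (h : TreeAut m) :
    (treeClosure G).map (MulAut.conj h).toMonoidHom ≤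
      treeClosure (G.map (MulAut.conj h).toMonoidHom) := by
  rintro _ ⟨g, hg, rfl⟩
  rw [mem_treeClosure]
  intro n
  obtain ⟨k, hk, hgk⟩ := mem_treeClosure.1 hg n
  refine ⟨_, ⟨k, hk, rfl⟩, ?_⟩
  rw [← map_inv, ← map_mul]
  exact (levelStab_normal m n).conj_mem _ hgk h

theorem map_conj_treeClosure (G : Subgroup (TreeAut m)) (h : TreeAut m) :
    (treeClosure G).map (MulAut.conj h).toMonoidHom =
      treeClosure (G.map (MulAut.conj h).toMonoidHom) := by
  refine le_antisymm (map_conj_treeClosure_le G h) fun g hg => ?_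
  have H := map_conj_treeClosure_le (G.map (MulAut.conj h).toMonoidHom) h⁻¹
    (Subgroup.mem_map_of_mem _ hg)
  rw [Subgroup.map_map] at H
  have hid : (MulAut.conj h⁻¹).toMonoidHom.comp (MulAut.conj h).toMonoidHom =
      MonoidHom.id (TreeAut m) := by
    ext1 k
    simp [mul_assoc]
  rw [hid, Subgroup.map_id] at H
  exact ⟨_, H, by simp [mul_assoc]⟩

/-! ### The diagonal closure of an abelian state-closed group -/

theorem diag_iterate_mem_diagClosure {G : Subgroup (TreeAut m)} {a : TreeAut m} (ha : a ∈ G)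
    (i : ℕ) : diag^[i] a ∈ diagClosure G := Subgroup.subset_closure ⟨i, a, ha, rfl⟩

theorem le_diagClosure (G : Subgroup (TreeAut m)) : G ≤ diagClosure G :=
  fun _ ha => diag_iterate_mem_diagClosure ha 0

theorem le_star (G : Subgroup (TreeAut m)) : G ≤ star G :=
  (le_diagClosure G).trans (le_treeClosure _)

theorem diag_mem_diagClosure {G : Subgroup (TreeAut m)} {g : TreeAut m}
    (hg : g ∈ diagClosure G) : diag g ∈ diagClosure G := by
  have h : diagClosure G ≤ (diagClosure G).comap (diagHom m) := by
    refine (Subgroup.closure_le _).2 ?_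
    rintro _ ⟨i, a, ha, rfl⟩
    have := diag_iterate_mem_diagClosure ha (i + 1)
    rwa [Function.iterate_succ_apply'] at this
  exact h hg

theorem diag_mem_treeClosure {G : Subgroup (TreeAut m)} (h : ∀ g ∈ G, diag g ∈ G)
    {g : TreeAut m} (hg : g ∈ treeClosure G) : diag g ∈ treeClosure G := by
  intro n
  obtain ⟨k, hk, hgk⟩ := hg (n - 1)
  refine ⟨diag k, h k hk, fun w hw => ?_⟩
  cases w with
  | nil => simp
  | cons y u => rw [act_diag_cons, act_diag_cons, hgk u (by simp [← hw])]

theorem diagClosure_le {G H : Subgroup (TreeAut m)} (h : ∀ g ∈ H, diag g ∈ H) (hGH : G ≤ H) :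
    diagClosure G ≤ H := by
  refine (Subgroup.closure_le _).2 ?_
  rintro _ ⟨i, a, ha, rfl⟩
  exact Function.Iterate.rec (fun g => g ∈ H) (hGH ha) h i

/-- In a state-closed abelian group `G`, an element `a` commutes with `b^(k)`: by state-closedness
this descends to the states of `a` and `b^(k-1)`. -/
theorem commute_diag_iterate {G : Subgroup (TreeAut m)} (hab : ∀ a ∈ G, ∀ b ∈ G, a * b = b * a)
    (hsc : StateClosed G) {a b : TreeAut m} (ha : a ∈ G) (hb : b ∈ G) (k : ℕ) :
    Commute a (diag^[k] b) := by
  induction k generalizing a with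
  | zero => exact hab a ha b hb
  | succ k ih =>
    rw [Function.iterate_succ_apply']
    refine ext_act fun w => ?_
    cases w with
    | nil => simp
    | cons y u =>
      have h := congrArg (fun g => act g u) (ih (hsc a ha [y])).eq
      simp only [act_mul] at h
      obtain ⟨z, hz⟩ := List.length_eq_one_iff.1 (a.length_act [y])
      rw [act_mul, act_mul, act_diag_cons, act_cons, act_cons a y u, hz, h]
      rfl

theorem commute_diag_iterate_diag_iterate {G : Subgroup (TreeAut m)}
    (hab : ∀ a ∈ G, ∀ b ∈ G, a * b = b * a) (hsc : StateClosed G) {a b : TreeAut m}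
    (ha : a ∈ G) (hb : b ∈ G) (i k : ℕ) : Commute (diag^[i] a) (diag^[k] b) := by
  wlog h : i ≤ k generalizing a b i k
  · exact (this hb ha k i (by omega)).symm
  obtain ⟨l, rfl⟩ := Nat.exists_eq_add_of_le h
  rw [Function.iterate_add_apply]
  exact (commute_diag_iterate hab hsc ha hb l).map (diagIterHom m i)

theorem comm_closure_of_comm {S : Set (TreeAut m)} (h : ∀ a ∈ S, ∀ b ∈ S, a * b = b * a) :
    ∀ a ∈ Subgroup.closure S, ∀ b ∈ Subgroup.closure S, a * b = b * a := by
  intro a ha b hb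
  have h1 : Subgroup.closure S ≤ Subgroup.centralizer S :=
    (Subgroup.closure_le _).2 fun a ha b hb => h b hb a ha
  have h2 := Subgroup.closure_le_centralizer_centralizer S hb
  exact h2 a (h1 ha)

theorem comm_treeClosure {G : Subgroup (TreeAut m)} (h : ∀ a ∈ G, ∀ b ∈ G, a * b = b * a) :
    ∀ a ∈ treeClosure G, ∀ b ∈ treeClosure G, a * b = b * a := by
  intro a ha b hb
  refine ext_act fun w => ?_
  obtain ⟨k, hk, hak⟩ := ha w.length
  obtain ⟨l, hl, hbl⟩ := hb w.length
  rw [act_mul, act_mul, hak _ (b.length_act w), hak w rfl, hbl w rfl, hbl _ (k.length_act w),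
    ← act_mul, h k hk l hl, act_mul]

theorem stateClosed_of_letter {G : Subgroup (TreeAut m)}
    (h : ∀ g ∈ G, ∀ y : Fin m, g.state [y] ∈ G) : StateClosed G := by
  intro g hg u
  induction u generalizing g with
  | nil => rwa [state_nil]
  | cons y u ih =>
    rw [state_cons]
    exact ih _ (h g hg y)

theorem stateClosed_closure {S : Set (TreeAut m)}
    (h : ∀ g ∈ S, ∀ y : Fin m, g.state [y] ∈ Subgroup.closure S) :
    StateClosed (Subgroup.closure S) := by
  refine stateClosed_of_letter fun g hg => ?_
  induction hg using Subgroup.closure_induction with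
  | mem g hg => exact h g hg
  | one => exact fun y => by simp
  | mul a b _ _ iha ihb =>
    intro y
    obtain ⟨z, hz⟩ := List.length_eq_one_iff.1 (b.length_act [y])
    rw [state_mul, hz]
    exact mul_mem (iha z) (ihb y)
  | inv a _ iha =>
    intro y
    obtain ⟨z, hz⟩ := List.length_eq_one_iff.1 (a⁻¹.length_act [y])
    rw [state_inv, hz]
    exact inv_mem (iha z)

theorem stateClosed_diagClosure {G : Subgroup (TreeAut m)} (hsc : StateClosed G) :
    StateClosed (diagClosure G) := by
  refine stateClosed_closure ?_
  rintro _ ⟨i, a, ha, rfl⟩ y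
  cases i with
  | zero => exact le_diagClosure G (hsc a ha [y])
  | succ i =>
    rw [Function.iterate_succ_apply', state_diag]
    exact diag_iterate_mem_diagClosure ha i

theorem stateClosed_treeClosure {G : Subgroup (TreeAut m)} (hsc : StateClosed G) :
    StateClosed (treeClosure G) := by
  intro g hg u n
  obtain ⟨k, hk, hgk⟩ := hg (u.length + n)
  refine ⟨k.state u, hsc k hk u, fun w hw => ?_⟩
  have h := hgk (u ++ w) (by simp [hw])
  rw [act_append_state, act_append_state] at h
  exact (List.append_inj h (by rw [length_act, length_act])).2

/-! ### Saturated groups -/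

/-- A subgroup is *saturated* if it is abelian, transitive on the first level, state-closed,
invariant under the diagonal map and closed. These are the properties of `A*` for `A` abelian,
transitive and state-closed. -/
structure IsSaturated (B : Subgroup (TreeAut m)) : Prop where
  comm : ∀ a ∈ B, ∀ b ∈ B, a * b = b * a
  trans : Transitive B
  stateClosed : StateClosed B
  diag_mem : ∀ b ∈ B, diag b ∈ B
  closed : treeClosure B ≤ B

theorem isSaturated_treeClosure {G : Subgroup (TreeAut m)}
    (hab : ∀ a ∈ G, ∀ b ∈ G, a * b = b * a) (htr : Transitive G) (hsc : StateClosed G)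
    (hd : ∀ g ∈ G, diag g ∈ G) : IsSaturated (treeClosure G) where
  comm := comm_treeClosure hab
  trans y z := let ⟨g, hg, h⟩ := htr y z; ⟨g, le_treeClosure G hg, h⟩
  stateClosed := stateClosed_treeClosure hsc
  diag_mem _ := diag_mem_treeClosure hd
  closed := (treeClosure_idem _).le

theorem isSaturated_star {A : Subgroup (TreeAut m)} (hab : ∀ a ∈ A, ∀ b ∈ A, a * b = b * a)
    (htr : Transitive A) (hsc : StateClosed A) : IsSaturated (star A) := by
  refine isSaturated_treeClosure (comm_closure_of_comm ?_)
    (fun y z => let ⟨g, hg, h⟩ := htr y z; ⟨g, le_diagClosure A hg, h⟩)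
    (stateClosed_diagClosure hsc) fun _ => diag_mem_diagClosure
  rintro _ ⟨i, a, ha, rfl⟩ _ ⟨k, b, hb, rfl⟩
  exact commute_diag_iterate_diag_iterate hab hsc ha hb i k

/-- The permutation of the first level induced by a tree automorphism. -/
def levelOnePerm (m : ℕ) : TreeAut m →* Equiv.Perm (Fin m) :=
  MonoidHom.toHomPerm
    { toFun g y := (g.act [y]).headD y
      map_one' := rfl
      map_mul' g h := funext fun y => by
        obtain ⟨z, hz⟩ := List.length_eq_one_iff.1 (h.length_act [y])
        obtain ⟨t, ht⟩ := List.length_eq_one_iff.1 (g.length_act [z])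
        change ((g * h).act [y]).headD y = (g.act [(h.act [y]).headD y]).headD _
        simp [act_mul, hz, ht] }

theorem act_singleton (g : TreeAut m) (y : Fin m) : g.act [y] = [levelOnePerm m g y] := by
  obtain ⟨z, hz⟩ := List.length_eq_one_iff.1 (g.length_act [y])
  change g.act [y] = [(g.act [y]).headD y]
  rw [hz]
  rfl

theorem levelOnePerm_eq_one {g : TreeAut m} : levelOnePerm m g = 1 ↔ g ∈ levelStab m 1 := by
  constructor
  · intro h w hw
    obtain ⟨y, rfl⟩ := List.length_eq_one_iff.1 hw
    rw [act_singleton, h, Equiv.Perm.one_apply]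
  · intro h
    ext1 y
    simpa [act_singleton] using h [y] rfl

namespace IsSaturated

variable {B : Subgroup (TreeAut m)}

/-- On the first level a saturated group is abelian and transitive, hence regular. -/
theorem card_map_levelOnePerm (hB : IsSaturated B) (hm : 0 < m) :
    Nat.card (B.map (levelOnePerm m)) = m := by
  have key : Function.Bijective
      (fun p : B.map (levelOnePerm m) => (p : Equiv.Perm (Fin m)) ⟨0, hm⟩) := by
    constructor
    · rintro ⟨_, a, ha, rfl⟩ ⟨_, b, hb, rfl⟩ h
      refine Subtype.ext (Equiv.ext fun z => ?_)
      obtain ⟨g, hg, hgz⟩ := hB.trans ⟨0, hm⟩ z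
      have hz : levelOnePerm m g ⟨0, hm⟩ = z := by
        simpa [act_singleton] using hgz
      have h1 := congrArg (levelOnePerm m) (hB.comm a ha g hg)
      have h2 := congrArg (levelOnePerm m) (hB.comm b hb g hg)
      rw [map_mul, map_mul] at h1 h2
      have h3 := Equiv.ext_iff.1 h1 ⟨0, hm⟩
      have h4 := Equiv.ext_iff.1 h2 ⟨0, hm⟩
      simp only [Equiv.Perm.mul_apply, hz] at h3 h4
      simp only at h
      simp only [h3, h4, h]
    · intro z
      obtain ⟨g, hg, hgz⟩ := hB.trans ⟨0, hm⟩ z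
      exact ⟨⟨_, g, hg, rfl⟩, by simpa [act_singleton] using hgz⟩
  simpa using Nat.card_congr (Equiv.ofBijective _ key)

theorem pow_mem_levelStab_one (hB : IsSaturated B) (hm : 0 < m) {b : TreeAut m} (hb : b ∈ B) :
    b ^ m ∈ levelStab m 1 := by
  have h := pow_card_eq_one' (x := (⟨_, b, hb, rfl⟩ : B.map (levelOnePerm m)))
  rw [hB.card_map_levelOnePerm hm] at h
  rw [← levelOnePerm_eq_one, map_pow]
  exact congrArg Subtype.val h

/-- The states of an element that fixes the first level are permuted transitively by the group,
without being changed, as the group is abelian. -/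
theorem exists_diag_eq (hB : IsSaturated B) (hm : 0 < m) {b : TreeAut m} (hb : b ∈ B)
    (h1 : b ∈ levelStab m 1) : ∃ c ∈ B, diag c = b := by
  refine ⟨b.state [⟨0, hm⟩], hB.stateClosed b hb _, ext_act fun w => ?_⟩
  cases w with
  | nil => simp
  | cons z u =>
    obtain ⟨g, hg, hgz⟩ := hB.trans ⟨0, hm⟩ z
    have h := congrArg (state [⟨0, hm⟩]) (hB.comm b hb g hg)
    rw [state_mul, state_mul, hgz, h1 _ rfl,
      hB.comm _ (hB.stateClosed g hg _) _ (hB.stateClosed b hb _)] at h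
    rw [act_cons b, h1 _ rfl, mul_right_cancel h]
    rfl

theorem diag_iterate_mem (hB : IsSaturated B) {b : TreeAut m} (hb : b ∈ B) (n : ℕ) :
    diag^[n] b ∈ B := Function.Iterate.rec (fun g => g ∈ B) hb hB.diag_mem n

theorem exists_diag_iterate_eq (hB : IsSaturated B) (hm : 0 < m) {b : TreeAut m} (hb : b ∈ B)
    {n : ℕ} (hn : b ∈ levelStab m n) : ∃ c ∈ B, diag^[n] c = b := by
  induction n generalizing b with
  | zero => exact ⟨b, hb, rfl⟩
  | succ n ih =>
    obtain ⟨c, hc, rfl⟩ := hB.exists_diag_eq hm hb (levelStab_antitone hm (by omega) hn)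
    obtain ⟨d, hd, rfl⟩ := ih hc ((diag_mem_levelStab_succ hm).1 hn)
    exact ⟨d, hd, Function.iterate_succ_apply' ..⟩

theorem mul_pow_of_mem (hB : IsSaturated B) {a b : TreeAut m} (ha : a ∈ B) (hb : b ∈ B) (n : ℕ) :
    (a * b) ^ n = a ^ n * b ^ n := Commute.mul_pow (hB.comm a ha b hb) n

/-- `m`-th powers raise the depth. -/
theorem pow_mem_levelStab_succ (hB : IsSaturated B) (hm : 0 < m) {b : TreeAut m} (hb : b ∈ B)
    {n : ℕ} (hn : b ∈ levelStab m n) : b ^ m ∈ levelStab m (n + 1) := by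
  obtain ⟨c, hc, rfl⟩ := hB.exists_diag_iterate_eq hm hb hn
  rw [← diag_iterate_pow, diag_iterate_mem_levelStab hm]
  exact hB.pow_mem_levelStab_one hm hc

/-- The quotients of the filtration of `B` by the level stabilizers have prime order, so that an
element of depth `n` generates the `n`-th one. -/
theorem exists_zpow (hB : IsSaturated B) (hm : m.Prime) {b s : TreeAut m} (hb : b ∈ B)
    (hs : s ∈ B) {n : ℕ} (hbn : b ∈ levelStab m n) (hsn : s ∈ levelStab m n)
    (hsn' : s ∉ levelStab m (n + 1)) : ∃ t : ℤ, (s ^ t)⁻¹ * b ∈ levelStab m (n + 1) := by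
  have : Fact m.Prime := ⟨hm⟩
  obtain ⟨c, hc, rfl⟩ := hB.exists_diag_iterate_eq hm.pos hb hbn
  obtain ⟨r, hr, rfl⟩ := hB.exists_diag_iterate_eq hm.pos hs hsn
  rw [diag_iterate_mem_levelStab hm.pos, ← levelOnePerm_eq_one] at hsn'
  obtain ⟨t, ht⟩ := mem_zpowers_of_prime_card (hB.card_map_levelOnePerm hm.pos)
    (g := ⟨_, r, hr, rfl⟩) (g' := ⟨_, c, hc, rfl⟩)
    (fun h => hsn' (congrArg Subtype.val h))
  refine ⟨t, ?_⟩
  rw [← diag_iterate_zpow, ← diag_iterate_inv, ← diag_iterate_mul,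
    diag_iterate_mem_levelStab hm.pos, ← levelOnePerm_eq_one, map_mul, map_inv, map_zpow,
    inv_mul_eq_one]
  exact congrArg Subtype.val ht

theorem dvd_of_zpow_mem (hB : IsSaturated B) (hm : m.Prime) {s : TreeAut m} (hs : s ∈ B) {n : ℕ}
    (hsn : s ∈ levelStab m n) (hsn' : s ∉ levelStab m (n + 1)) {t : ℤ}
    (ht : s ^ t ∈ levelStab m (n + 1)) : (m : ℤ) ∣ t := by
  by_contra h
  have hco : IsCoprime (m : ℤ) t :=
    (Nat.prime_iff_prime_int.1 hm).irreducible.coprime_iff_not_dvd.2 h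
  obtain ⟨a, b, hab⟩ := hco
  apply hsn'
  rw [← zpow_one s, ← hab, zpow_add, mul_comm a, mul_comm b, zpow_mul, zpow_mul]
  refine mul_mem (zpow_mem ?_ _) (zpow_mem ht _)
  rw [zpow_natCast]
  exact hB.pow_mem_levelStab_succ hm.pos hs hsn

/-- A sequence with one element of each depth generates a dense subgroup. -/
theorem treeClosure_eq_of_depth (hB : IsSaturated B) (hm : m.Prime) {H : Subgroup (TreeAut m)}
    (hH : H ≤ B)
    (h : ∀ k, ∃ s ∈ H, s ∈ levelStab m k ∧ s ∉ levelStab m (k + 1)) : treeClosure H = B := by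
  refine le_antisymm ((treeClosure_mono hH).trans hB.closed) fun b hb => ?_
  rw [mem_treeClosure]
  intro n
  induction n with
  | zero => exact ⟨1, one_mem _, mem_levelStab_zero _⟩
  | succ n ih =>
    obtain ⟨k, hk, hkb⟩ := ih
    obtain ⟨s, hs, hsn, hsn'⟩ := h n
    obtain ⟨t, ht⟩ := hB.exists_zpow hm (mul_mem (inv_mem (hH hk)) hb) (hH hs) hkb hsn hsn'
    refine ⟨k * s ^ t, mul_mem hk (zpow_mem hs t), ?_⟩
    rwa [mul_inv_rev, mul_assoc]

theorem diag_iterate_depth (hm : 0 < m) {β : TreeAut m} (hβ : β ∉ levelStab m 1) (k : ℕ) :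
    diag^[k] β ∈ levelStab m k ∧ diag^[k] β ∉ levelStab m (k + 1) := by
  rw [diag_iterate_mem_levelStab hm]
  exact ⟨(diag_iterate_mem_levelStab hm k 0).2 (mem_levelStab_zero _), hβ⟩

theorem star_zpowers_eq (hB : IsSaturated B) (hm : m.Prime) {β : TreeAut m} (hβ : β ∈ B)
    (hβ1 : β ∉ levelStab m 1) : star (Subgroup.zpowers β) = B :=
  hB.treeClosure_eq_of_depth hm
    (diagClosure_le hB.diag_mem ((Subgroup.zpowers_le).2 hβ)) fun k =>
      ⟨_, diag_iterate_mem_diagClosure (Subgroup.mem_zpowers β) k,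
        diag_iterate_depth hm.pos hβ1 k⟩

theorem exists_notMem_levelStab_one {A : Subgroup (TreeAut m)} (htr : Transitive A)
    (hm : m.Prime) : ∃ β ∈ A, β ∉ levelStab m 1 := by
  obtain ⟨g, hg, h⟩ := htr ⟨0, hm.pos⟩ ⟨1, hm.one_lt⟩
  refine ⟨g, hg, fun h1 => ?_⟩
  rw [h1 _ rfl] at h
  simp at h

/-- If some element of depth `0` has its `m`-th power in `Stab(j)`, then so have all elements: by
downward induction on the depth `i` of `b`, splitting off a power of `β^(i)`. -/
theorem pow_mem_levelStab (hB : IsSaturated B) (hm : m.Prime) {β : TreeAut m} (hβ : β ∈ B)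
    (hβ1 : β ∉ levelStab m 1) {j : ℕ} (hj : β ^ m ∈ levelStab m j) {b : TreeAut m} (hb : b ∈ B) :
    b ^ m ∈ levelStab m j := by
  suffices H : ∀ d i, i + d = j → ∀ b ∈ B, b ∈ levelStab m i → b ^ m ∈ levelStab m j from
    H j 0 (zero_add j) b hb (mem_levelStab_zero b)
  intro d
  induction d with
  | zero =>
    rintro i rfl b _ hbi
    exact pow_mem hbi m
  | succ d ih =>
    intro i hi b hb hbi
    obtain ⟨h1, h2⟩ := diag_iterate_depth hm.pos hβ1 i
    have hs := hB.diag_iterate_mem hβ i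
    obtain ⟨t, ht⟩ := hB.exists_zpow hm hb hs hbi h1 h2
    have hc : ((diag^[i] β) ^ t)⁻¹ * b ∈ B := mul_mem (inv_mem (zpow_mem hs t)) hb
    have key := ih (i + 1) (by omega) _ hc ht
    rw [← mul_inv_cancel_left ((diag^[i] β) ^ t) b, hB.mul_pow_of_mem (zpow_mem hs t) hc]
    refine mul_mem ?_ key
    rw [← zpow_natCast, zpow_comm, zpow_natCast, ← diag_iterate_pow]
    refine zpow_mem (levelStab_antitone hm.pos (Nat.le_add_left j i) ?_) t
    exact (diag_iterate_mem_levelStab hm.pos i j).2 hj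

/-- Taking `m`-th powers shifts the depth of all elements by the same amount. -/
theorem pow_depth (hB : IsSaturated B) (hm : m.Prime) {β : TreeAut m} (hβ : β ∈ B)
    (hβ1 : β ∉ levelStab m 1) {j : ℕ} (hj : β ^ m ∈ levelStab m j)
    (hj' : β ^ m ∉ levelStab m (j + 1)) {b : TreeAut m} (hb : b ∈ B) {k : ℕ}
    (hk : b ∈ levelStab m k) (hk' : b ∉ levelStab m (k + 1)) :
    b ^ m ∈ levelStab m (k + j) ∧ b ^ m ∉ levelStab m (k + j + 1) := by
  obtain ⟨c, hc, rfl⟩ := hB.exists_diag_iterate_eq hm.pos hb hk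
  rw [diag_iterate_mem_levelStab hm.pos] at hk'
  rw [← diag_iterate_pow, add_assoc, diag_iterate_mem_levelStab hm.pos,
    diag_iterate_mem_levelStab hm.pos]
  exact ⟨hB.pow_mem_levelStab hm hβ hβ1 hj hc,
    fun h => hj' (hB.pow_mem_levelStab hm hc hk' h hβ)⟩

theorem pow_eq_one (hB : IsSaturated B) (hm : m.Prime) {β : TreeAut m} (hβ : β ∈ B)
    (hβ1 : β ∉ levelStab m 1) (h : β ^ m = 1) {b : TreeAut m} (hb : b ∈ B) : b ^ m = 1 :=
  eq_one_of_forall_mem_levelStab fun n =>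
    hB.pow_mem_levelStab hm hβ hβ1 (j := n) (h ▸ one_mem _) hb

/-- A saturated group that does not have exponent `m` is torsion-free: an element of finite order
has order divisible by `m`, and its `m`-th power is nontrivial of smaller order. -/
theorem eq_one_of_isOfFinOrder (hB : IsSaturated B) (hm : m.Prime) {β : TreeAut m} (hβ : β ∈ B)
    (hβ1 : β ∉ levelStab m 1) (h : β ^ m ≠ 1) {b : TreeAut m} (hb : b ∈ B)
    (hfin : IsOfFinOrder b) : b = 1 := by
  obtain ⟨j, hj, hj'⟩ := exists_mem_levelStab_notMem_succ h
  obtain ⟨N, hN, hbN⟩ := isOfFinOrder_iff_pow_eq_one.1 hfin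
  clear hfin
  induction N using Nat.strong_induction_on generalizing b with
  | _ N ih =>
    by_contra hb1
    obtain ⟨k, hk, hk'⟩ := exists_mem_levelStab_notMem_succ hb1
    have hdvd : (m : ℤ) ∣ N := hB.dvd_of_zpow_mem hm hb hk hk' (by simp [hbN, one_mem])
    obtain ⟨M, rfl⟩ := Int.natCast_dvd_natCast.1 hdvd
    have hM : 0 < M := Nat.pos_of_mul_pos_left hN
    have := ih M (by nlinarith [hm.two_le]) (pow_mem hb m) hM (by rw [← pow_mul, hbN])
    exact (hB.pow_depth hm hβ hβ1 hj hj' hb hk hk').2 (this ▸ one_mem _)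

end IsSaturated

/-! ### Conjugacy of saturated groups -/

namespace IsSaturated

variable {B : Subgroup (TreeAut m)}

theorem exists_act_eq (hB : IsSaturated B) (y₀ : Fin m) (w : List (Fin m)) :
    ∃ b ∈ B, b.act (List.replicate w.length y₀) = w := by
  obtain ⟨n, hn⟩ : ∃ n, w.length = n := ⟨_, rfl⟩
  induction n generalizing w with
  | zero => exact ⟨1, one_mem _, by simp [List.length_eq_zero_iff.1 hn]⟩
  | succ n ih =>
    cases w with
    | nil => simp at hn
    | cons z u =>
      obtain ⟨g, hg, hgz⟩ := hB.trans y₀ z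
      obtain ⟨c, hc, hcu⟩ := ih ((g.state [y₀])⁻¹.act u) (by simpa [length_act] using hn)
      rw [length_act] at hcu
      refine ⟨g * diag c, mul_mem hg (hB.diag_mem c hc), ?_⟩
      rw [List.length_cons, List.replicate_succ, act_mul, act_diag_cons, hcu, act_cons, hgz,
        act_act_inv]
      rfl

/-- A saturated group is abelian and transitive, hence regular, on each level. -/
theorem mem_levelStab_of_act_eq (hB : IsSaturated B) (y₀ : Fin m) {b : TreeAut m} (hb : b ∈ B)
    {n : ℕ} (h : b.act (List.replicate n y₀) = List.replicate n y₀) : b ∈ levelStab m n := by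
  rintro w rfl
  obtain ⟨g, hg, hgw⟩ := hB.exists_act_eq y₀ w
  have hc := congrArg (fun k => act k (List.replicate w.length y₀)) (hB.comm b hb g hg)
  simpa only [act_mul, hgw, h] using hc

end IsSaturated

/-- Two actions of a group `F` of pairs that are transitive on all levels, with the same stabilizers
of the vertices `y₀ⁿ`, are conjugate: `h` takes `p.1 (y₀ⁿ)` to `p.2 (y₀ⁿ)`. -/
theorem exists_conj_of_stabilizers {F : Subgroup (TreeAut m × TreeAut m)} (y₀ : Fin m)
    (hst : ∀ p ∈ F, ∀ n, p.1.act (List.replicate n y₀) = List.replicate n y₀ ↔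
      p.2.act (List.replicate n y₀) = List.replicate n y₀)
    (h₁ : ∀ w, ∃ p ∈ F, p.1.act (List.replicate w.length y₀) = w)
    (h₂ : ∀ w, ∃ p ∈ F, p.2.act (List.replicate w.length y₀) = w) :
    ∃ h : TreeAut m, ∀ p ∈ F, h * p.1 * h⁻¹ = p.2 := by
  choose f hf hfw using h₁
  choose g hg hgw using h₂
  have key : ∀ p ∈ F, ∀ q ∈ F, ∀ n,
      p.1.act (List.replicate n y₀) = q.1.act (List.replicate n y₀) ↔
        p.2.act (List.replicate n y₀) = q.2.act (List.replicate n y₀) := by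
    intro p hp q hq n
    have H : ∀ (a b : TreeAut m) (w : List (Fin m)),
        (b⁻¹ * a).act w = w ↔ a.act w = b.act w := fun a b w => by
      rw [act_mul]
      exact ⟨fun h => by rw [← act_act_inv b (a.act w), h], fun h => by rw [h, act_inv_act]⟩
    have := hst _ (mul_mem (inv_mem hq) hp) n
    rwa [Prod.fst_mul, Prod.snd_mul, Prod.fst_inv, Prod.snd_inv, H, H] at this
  let φ : List (Fin m) → List (Fin m) := fun w => (f w).2.act (List.replicate w.length y₀)
  let ψ : List (Fin m) → List (Fin m) := fun w => (g w).1.act (List.replicate w.length y₀)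
  have hφ : ∀ p ∈ F, ∀ n, φ (p.1.act (List.replicate n y₀)) = p.2.act (List.replicate n y₀) := by
    intro p hp n
    have hl : (p.1.act (List.replicate n y₀)).length = n := by simp [length_act]
    have := hfw (p.1.act (List.replicate n y₀))
    simp only [φ]
    rw [hl] at this ⊢
    exact (key _ (hf _) p hp n).1 this
  have hψ : ∀ p ∈ F, ∀ n, ψ (p.2.act (List.replicate n y₀)) = p.1.act (List.replicate n y₀) := by
    intro p hp n
    have hl : (p.2.act (List.replicate n y₀)).length = n := by simp [length_act]
    have := hgw (p.2.act (List.replicate n y₀))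
    simp only [ψ]
    rw [hl] at this ⊢
    exact (key _ (hg _) p hp n).2 this
  have hφl : ∀ w, (φ w).length = w.length := fun w => by simp [φ, length_act]
  have hl : Function.LeftInverse ψ φ := fun w => (hψ _ (hf w) _).trans (hfw w)
  have hr : Function.RightInverse ψ φ := fun w => (hφ _ (hg w) _).trans (hgw w)
  have hmono : ∀ u v, u <+: v → φ u <+: φ v := by
    intro u v huv
    have hk : List.replicate u.length y₀ <+: List.replicate v.length y₀ :=
      List.prefix_replicate_iff.2 ⟨by simpa using huv.length_le, by simp⟩
    have hu : (f v).1.act (List.replicate u.length y₀) = u := by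
      have h1 := ((f v).1.act_prefix _ _).2 hk
      rw [hfw] at h1
      exact (List.prefix_of_prefix_length_le h1 huv (by simp [length_act])).eq_of_length
        (by simp [length_act])
    have h2 := ((f v).2.act_prefix _ _).2 hk
    rwa [← hφ _ (hf v), ← hφ _ (hf v), hu, hfw] at h2
  let h : TreeAut m := ⟨⟨φ, ψ, hl, hr⟩, fun u v => by
    refine ⟨fun huv => ?_, hmono u v⟩
    change φ u <+: φ v at huv
    have hle : u.length ≤ v.length := by simpa [hφl] using huv.length_le
    have h1 : φ (v.take u.length) = φ u :=
      (List.prefix_of_prefix_length_le (hmono _ _ (List.take_prefix _ _)) huv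
        (by simp [hφl])).eq_of_length (by simp [hφl, hle])
    rw [← hl.injective h1]
    exact List.take_prefix _ _⟩
  refine ⟨h, fun p hp => ?_⟩
  rw [mul_inv_eq_iff_eq_mul]
  refine ext_act fun w => ?_
  rw [act_mul, act_mul, ← hfw w, ← act_mul]
  change φ ((p * f w).1.act _) = p.2.act (φ _)
  rw [hφ _ (mul_mem hp (hf w)), hφ _ (hf w)]
  rfl

/-- Two saturated groups are conjugate if they contain sequences of elements `β k`, `γ k` of depth
`k` such that `β k ^ m` and `γ k ^ m` are given by the same expression in the later terms. Then the
group `F` generated by the pairs `(β k, γ k)` is dense in both groups and induces the same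
stabilizers: dividing out powers of the first generators, which are `m`-th powers if one of the two
components has larger depth, shows that a pair in `F` has components of the same depth. -/
theorem IsSaturated.conj_of_depth {B C : Subgroup (TreeAut m)} (hB : IsSaturated B)
    (hC : IsSaturated C) (hm : m.Prime) {β γ : ℕ → TreeAut m} (hβ : ∀ k, β k ∈ B)
    (hβd : ∀ k, β k ∈ levelStab m k ∧ β k ∉ levelStab m (k + 1)) (hγ : ∀ k, γ k ∈ C)
    (hγd : ∀ k, γ k ∈ levelStab m k ∧ γ k ∉ levelStab m (k + 1))
    (hpow : ∀ k, (β k, γ k) ^ m ∈ Subgroup.closure {p | ∃ l, k + 1 ≤ l ∧ p = (β l, γ l)}) :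
    Conj B C := by
  let F : ℕ → Subgroup (TreeAut m × TreeAut m) := fun k =>
    Subgroup.closure {p | ∃ l, k ≤ l ∧ p = (β l, γ l)}
  have hFmem : ∀ k l, k ≤ l → (β l, γ l) ∈ F k := fun k l h => Subgroup.subset_closure ⟨l, h, rfl⟩
  have hFle : ∀ k, F k ≤ B.prod C := fun k => (Subgroup.closure_le _).2 <| by
    rintro _ ⟨l, _, rfl⟩
    exact ⟨hβ l, hγ l⟩
  have hFst : ∀ k, F k ≤ (levelStab m k).prod (levelStab m k) :=
    fun k => (Subgroup.closure_le _).2 <| by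
      rintro _ ⟨l, hl, rfl⟩
      exact ⟨levelStab_antitone hm.pos hl (hβd l).1, levelStab_antitone hm.pos hl (hγd l).1⟩
  have hcomm : ∀ k, ∀ p ∈ F k, ∀ q ∈ F k, p * q = q * p := fun k p hp q hq =>
    Prod.ext (hB.comm _ (hFle k hp).1 _ (hFle k hq).1) (hC.comm _ (hFle k hp).2 _ (hFle k hq).2)
  have hFanti : ∀ k, F (k + 1) ≤ F k := fun k => Subgroup.closure_mono <| by
    rintro _ ⟨l, hl, rfl⟩
    exact ⟨l, by omega, rfl⟩
  have hdec : ∀ k, ∀ p ∈ F k, ∃ t : ℤ, ∃ q ∈ F (k + 1), p = (β k, γ k) ^ t * q := by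
    intro k p hp
    induction hp using Subgroup.closure_induction with
    | mem p hp =>
      obtain ⟨l, hl, rfl⟩ := hp
      rcases hl.eq_or_lt with rfl | hl
      · exact ⟨1, 1, one_mem _, by simp⟩
      · exact ⟨0, _, hFmem _ _ hl, by simp⟩
    | one => exact ⟨0, 1, one_mem _, by simp⟩
    | mul p p' _ _ ih ih' =>
      obtain ⟨t, q, hq, rfl⟩ := ih
      obtain ⟨t', q', hq', rfl⟩ := ih'
      refine ⟨t + t', q * q', mul_mem hq hq', ?_⟩
      have := hcomm k q (hFanti k hq) _ (zpow_mem (hFmem k k le_rfl) t')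
      rw [zpow_add, mul_assoc, ← mul_assoc q, this]
      simp only [mul_assoc]
    | inv p _ ih =>
      obtain ⟨t, q, hq, rfl⟩ := ih
      refine ⟨-t, q⁻¹, inv_mem hq, ?_⟩
      rw [mul_inv_rev, zpow_neg]
      exact hcomm k _ (inv_mem (hFanti k hq)) _ (inv_mem (zpow_mem (hFmem k k le_rfl) t))
  have hstep : ∀ k, ∀ p ∈ F k, (p.1 ∈ levelStab m (k + 1) ∨ p.2 ∈ levelStab m (k + 1)) →
      p ∈ F (k + 1) := by
    intro k p hp h
    obtain ⟨t, q, hq, rfl⟩ := hdec k p hp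
    have hdvd : (m : ℤ) ∣ t := by
      rcases h with h | h
      · exact hB.dvd_of_zpow_mem hm (hβ k) (hβd k).1 (hβd k).2
          ((Subgroup.mul_mem_cancel_right _ (hFst _ hq).1).1 h)
      · exact hC.dvd_of_zpow_mem hm (hγ k) (hγd k).1 (hγd k).2
          ((Subgroup.mul_mem_cancel_right _ (hFst _ hq).2).1 h)
    obtain ⟨t, rfl⟩ := hdvd
    rw [zpow_mul, zpow_natCast]
    exact mul_mem (zpow_mem (hpow k) t) hq
  have hFn : ∀ n, ∀ p ∈ F 0, (p.1 ∈ levelStab m n ∨ p.2 ∈ levelStab m n) → p ∈ F n := by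
    intro n p hp
    induction n with
    | zero => exact fun _ => hp
    | succ n ih =>
      have hle := levelStab_antitone hm.pos (Nat.le_succ n)
      exact fun h => hstep n p (ih (h.imp (fun h => hle h) fun h => hle h)) h
  have hB' : treeClosure ((F 0).map (MonoidHom.fst _ _)) = B :=
    hB.treeClosure_eq_of_depth hm
      (Subgroup.map_le_iff_le_comap.2 fun p hp => (hFle 0 hp).1) fun k =>
        ⟨β k, ⟨_, hFmem 0 k (Nat.zero_le k), rfl⟩, hβd k⟩
  have hC' : treeClosure ((F 0).map (MonoidHom.snd _ _)) = C :=
    hC.treeClosure_eq_of_depth hm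
      (Subgroup.map_le_iff_le_comap.2 fun p hp => (hFle 0 hp).2) fun k =>
        ⟨γ k, ⟨_, hFmem 0 k (Nat.zero_le k), rfl⟩, hγd k⟩
  let y₀ : Fin m := ⟨0, hm.pos⟩
  obtain ⟨h, hh⟩ := exists_conj_of_stabilizers (F := F 0) y₀
    (fun p hp n => ⟨fun h => (hFst n (hFn n p hp
          (Or.inl (hB.mem_levelStab_of_act_eq y₀ (hFle 0 hp).1 h)))).2 _ (by simp),
        fun h => (hFst n (hFn n p hp
          (Or.inr (hC.mem_levelStab_of_act_eq y₀ (hFle 0 hp).2 h)))).1 _ (by simp)⟩)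
    (fun w => by
      obtain ⟨b, hb, hbw⟩ := hB.exists_act_eq y₀ w
      rw [← hB'] at hb
      obtain ⟨_, ⟨p, hp, rfl⟩, hpb⟩ := hb w.length
      exact ⟨p, hp, (hpb _ (by simp)).symm.trans hbw⟩)
    (fun w => by
      obtain ⟨c, hc, hcw⟩ := hC.exists_act_eq y₀ w
      rw [← hC'] at hc
      obtain ⟨_, ⟨p, hp, rfl⟩, hpc⟩ := hc w.length
      exact ⟨p, hp, (hpc _ (by simp)).symm.trans hcw⟩)
  refine ⟨h, ?_⟩
  rw [← hB', ← hC', map_conj_treeClosure]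
  congr 1
  ext g
  constructor
  · rintro ⟨_, ⟨p, hp, rfl⟩, rfl⟩
    exact ⟨p, hp, (hh p hp).symm⟩
  · rintro ⟨p, hp, rfl⟩
    exact ⟨_, ⟨p, hp, rfl⟩, hh p hp⟩

/-! ### Generalized adding machines -/

theorem addFun_comm (j : ℕ) (w : List (Fin m)) :
    ∀ a b, addFun j a (addFun j b w) = addFun j b (addFun j a w) := by
  induction w with
  | nil => intro a b; cases a <;> cases b <;> rfl
  | cons y u ih =>
    rintro (_ | a) (_ | b)
    · rfl
    all_goals
      simp only [addFun]
      try split_ifs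
    all_goals first | rw [ih] | rfl

theorem addAut_comm (j a b : ℕ) : addAut m j a * addAut m j b = addAut m j b * addAut m j a :=
  ext_act fun w => addFun_comm j w a b

theorem diag_addAut (j k : ℕ) : diag (addAut m j k) = addAut m j (k + 1) := by
  rw [addAut_eq_diag, addAut_eq_diag, Function.iterate_succ_apply']

theorem state_addAut_zero (j : ℕ) (y : Fin m) :
    (addAut m j 0).state [y] = if (y : ℕ) + 1 = m then addAut m j (j - 1) else 1 := by
  refine ext_act fun u => ?_
  change (if (y : ℕ) + 1 = m then addFun j (j - 1) u else u) = _
  split_ifs <;> rfl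

theorem addingMachine_pow_act (j : ℕ) (u : List (Fin m)) (y k : ℕ) (h : y + k < m) :
    (addingMachine m j ^ k).act (⟨y, by omega⟩ :: u) = ⟨y + k, h⟩ :: u := by
  induction k with
  | zero => rfl
  | succ k ih =>
    rw [pow_succ', act_mul, ih (by omega)]
    change addFun j 0 _ = _
    obtain ⟨n, rfl⟩ : ∃ n, m = n + 1 := ⟨m - 1, by omega⟩
    rw [addFun, if_neg (by simp only; omega), finRotate_of_lt (by omega)]
    rfl

/-- The first letter runs once through the alphabet and produces exactly one carry. -/
theorem addingMachine_pow (hm : 0 < m) {j : ℕ} (hj : 1 ≤ j) :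
    addingMachine m j ^ m = addAut m j j := by
  obtain ⟨n, rfl⟩ : ∃ n, m = n + 1 := ⟨m - 1, by omega⟩
  obtain ⟨i, rfl⟩ : ∃ i, j = i + 1 := ⟨j - 1, by omega⟩
  refine ext_act fun w => ?_
  cases w with
  | nil => simp
  | cons y u =>
    obtain ⟨y, hy⟩ := y
    have h1 := addingMachine_pow_act (i + 1) u y (n - y) (by omega)
    have h2 : (addingMachine (n + 1) (i + 1)).act (⟨y + (n - y), by omega⟩ :: u) =
        ⟨0, hm⟩ :: addFun (i + 1) i u := by
      change addFun (i + 1) 0 _ = _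
      have : (⟨y + (n - y), by omega⟩ : Fin (n + 1)) = Fin.last n := Fin.ext (by simp; omega)
      rw [this, addFun, finRotate_last]
      simp
    have h3 := addingMachine_pow_act (i + 1) (addFun (i + 1) i u) 0 y (by omega)
    have h4 : addingMachine (n + 1) (i + 1) ^ (n + 1) = addingMachine (n + 1) (i + 1) ^ y *
        (addingMachine (n + 1) (i + 1) * addingMachine (n + 1) (i + 1) ^ (n - y)) := by
      rw [← pow_succ', ← pow_add, show y + (n - y + 1) = n + 1 by omega]
    rw [h4, act_mul, act_mul, h1, h2, h3]
    simp only [zero_add]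
    rfl

theorem finRotate_pow_self (hm : 2 ≤ m) : finRotate m ^ m = 1 := by
  have h := (isCycle_finRotate_of_le hm).orderOf
  rw [support_finRotate_of_le hm, Finset.card_univ, Fintype.card_fin] at h
  rw [← orderOf_dvd_iff_pow_eq_one, h]

theorem levelOnePerm_node (p : Equiv.Perm (Fin m)) (f : Fin m → TreeAut m) :
    levelOnePerm m (node p f) = p := rfl

theorem levelOnePerm_addingMachine (m j : ℕ) :
    levelOnePerm m (addingMachine m j) = finRotate m := by
  rw [addingMachine_eq, levelOnePerm_node]

theorem finRotate_ne_one (hm : 2 ≤ m) : finRotate m ≠ 1 := (isCycle_finRotate_of_le hm).ne_one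

theorem transitive_of_levelOnePerm (hm : 2 ≤ m) {G : Subgroup (TreeAut m)} {g : TreeAut m}
    (hg : g ∈ G) (h : levelOnePerm m g = finRotate m) : Transitive G := by
  intro y z
  have hs := support_finRotate_of_le hm
  have hne : ∀ x, finRotate m x ≠ x := fun x =>
    Equiv.Perm.mem_support.1 (hs ▸ Finset.mem_univ x)
  obtain ⟨i, hi⟩ := (isCycle_finRotate_of_le hm).sameCycle (hne y) (hne z)
  exact ⟨g ^ i, zpow_mem hg i, by rw [act_singleton, map_zpow, h, hi]⟩

/-- The states of the adding machine generate all its diagonal images: the states are `α^(k)` with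
`k < j`, and `α^(k+j)` is the `m`-th power of `α^(k)`. -/
theorem groupD_eq_closure (hm : 2 ≤ m) {j : ℕ} (hj : 1 ≤ j) :
    groupD m j = Subgroup.closure (Set.range (addAut m j)) := by
  have hlast : ((⟨m - 1, by omega⟩ : Fin m) : ℕ) + 1 = m := by simp only; omega
  refine le_antisymm ((Subgroup.closure_le _).2 ?_) ((Subgroup.closure_le _).2 ?_)
  · rintro _ ⟨u, rfl⟩
    refine stateClosed_closure ?_ _ (Subgroup.subset_closure (Set.mem_range_self 0)) u
    rintro _ ⟨k, rfl⟩ y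
    cases k with
    | zero =>
      rw [state_addAut_zero]
      split_ifs
      · exact Subgroup.subset_closure ⟨_, rfl⟩
      · exact one_mem _
    | succ k =>
      rw [← diag_addAut, state_diag]
      exact Subgroup.subset_closure ⟨_, rfl⟩
  · rintro _ ⟨k, rfl⟩
    have hsmall : ∀ i, i < j → addAut m j (j - 1 - i) ∈ groupD m j := by
      intro i hi
      refine Subgroup.subset_closure
        ⟨⟨m - 1, by omega⟩ :: List.replicate i ⟨0, by omega⟩, ?_⟩
      have : (addingMachine m j).state [⟨m - 1, by omega⟩] = addAut m j (j - 1) := by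
        rw [addingMachine, state_addAut_zero, if_pos hlast]
      rw [state_cons, this]
      clear this
      induction i with
      | zero => rw [List.replicate_zero, state_nil, Nat.sub_zero]
      | succ i ih =>
        rw [List.replicate_succ', state_append, ← ih (by omega),
          show j - 1 - i = j - 1 - (i + 1) + 1 by omega, ← diag_addAut, state_diag]
    induction k using Nat.strong_induction_on with
    | _ k ih =>
      by_cases hk : k < j
      · have := hsmall (j - 1 - k) (by omega)
        rwa [show j - 1 - (j - 1 - k) = k by omega] at this
      · have h := pow_mem (ih (k - j) (by omega)) m
        rwa [addAut_eq_diag, ← diag_iterate_pow, addingMachine_pow (by omega) hj, addAut_eq_diag,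
          ← Function.iterate_add_apply, ← addAut_eq_diag, show k - j + j = k by omega] at h

theorem isSaturated_treeClosure_groupD (hm : 2 ≤ m) {j : ℕ} (hj : 1 ≤ j) :
    IsSaturated (treeClosure (groupD m j)) := by
  refine isSaturated_treeClosure ?_ ?_ ?_ ?_
  · rw [groupD_eq_closure hm hj]
    refine comm_closure_of_comm ?_
    rintro _ ⟨a, rfl⟩ _ ⟨b, rfl⟩
    exact addAut_comm j a b
  · exact transitive_of_levelOnePerm hm (Subgroup.subset_closure ⟨[], (state_nil _).symm⟩)
      (levelOnePerm_addingMachine m j)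
  · refine stateClosed_closure ?_
    rintro _ ⟨u, rfl⟩ y
    exact Subgroup.subset_closure ⟨u ++ [y], (state_append _ _ _).symm⟩
  · rw [groupD_eq_closure hm hj]
    have h : Subgroup.closure (Set.range (addAut m j)) ≤
        (Subgroup.closure (Set.range (addAut m j))).comap (diagHom m) := by
      refine (Subgroup.closure_le _).2 ?_
      rintro _ ⟨k, rfl⟩
      exact Subgroup.subset_closure ⟨k + 1, (diag_addAut j k).symm⟩
    exact fun g hg => h hg

/-! ### The group `⟨σ⟩*` -/

theorem levelOnePerm_sigma (m : ℕ) : levelOnePerm m (sigma m) = finRotate m := rfl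

theorem sigma_act_cons (y : Fin m) (u : List (Fin m)) :
    (sigma m).act (y :: u) = finRotate m y :: u := rfl

theorem sigma_pow_act_cons (k : ℕ) (y : Fin m) (u : List (Fin m)) :
    (sigma m ^ k).act (y :: u) = (finRotate m ^ k) y :: u := by
  induction k with
  | zero => rfl
  | succ k ih => rw [pow_succ', act_mul, ih, sigma_act_cons, pow_succ', Equiv.Perm.mul_apply]

theorem sigma_pow_self (hm : 2 ≤ m) : sigma m ^ m = 1 := ext_act fun w => by
  cases w with
  | nil => simp
  | cons y u => rw [sigma_pow_act_cons, finRotate_pow_self hm]; rfl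

theorem sigma_notMem_levelStab_one (hm : 2 ≤ m) : sigma m ∉ levelStab m 1 := by
  rw [← levelOnePerm_eq_one, levelOnePerm_sigma]
  exact finRotate_ne_one hm

theorem isSaturated_star_sigma (hm : 2 ≤ m) : IsSaturated (star (Subgroup.zpowers (sigma m))) := by
  refine isSaturated_star ?_
    (transitive_of_levelOnePerm hm (Subgroup.mem_zpowers _) (levelOnePerm_sigma m)) ?_
  · rintro _ ⟨a, rfl⟩ _ ⟨b, rfl⟩
    exact zpow_mul_comm _ _ _
  · rw [Subgroup.zpowers_eq_closure]
    refine stateClosed_closure ?_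
    rintro _ rfl y
    exact one_mem _

/-- The function underlying `σ ^ c(0) * (σ ^ c(1))^x * (σ ^ c(2))^(x^2) * ...`, which rotates the
`k`-th letter by the representative of `c(k)` in `{0, ..., m - 1}`. -/
def rotateFun : (ℕ → ZMod m) → List (Fin m) → List (Fin m)
  | _, [] => []
  | c, y :: u => (finRotate m ^ (c 0).val) y :: rotateFun (fun k => c (k + 1)) u

theorem finRotate_pow_val_add (hm : 2 ≤ m) (a b : ZMod m) :
    finRotate m ^ (a + b).val = finRotate m ^ a.val * finRotate m ^ b.val := by
  have : NeZero m := ⟨by omega⟩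
  rw [← pow_add, ZMod.val_add]
  exact (pow_eq_pow_mod _ (finRotate_pow_self hm)).symm

theorem rotateFun_add (hm : 2 ≤ m) (c d : ℕ → ZMod m) (w : List (Fin m)) :
    rotateFun (c + d) w = rotateFun c (rotateFun d w) := by
  induction w generalizing c d with
  | nil => rfl
  | cons y u ih =>
    rw [rotateFun, rotateFun, rotateFun, Pi.add_apply, finRotate_pow_val_add hm,
      Equiv.Perm.mul_apply]
    exact congrArg _ (ih _ _)

theorem rotateFun_zero (w : List (Fin m)) : rotateFun (0 : ℕ → ZMod m) w = w := by
  induction w with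
  | nil => rfl
  | cons y u ih =>
    rw [rotateFun, Pi.zero_apply, ZMod.val_zero, pow_zero]
    exact congrArg _ ih

theorem rotateFun_prefix (c : ℕ → ZMod m) (v w : List (Fin m)) :
    rotateFun c v <+: rotateFun c w ↔ v <+: w := by
  induction v generalizing c w with
  | nil => simp [rotateFun]
  | cons y v ih =>
    cases w with
    | nil => simp [rotateFun]
    | cons z w => simp [rotateFun, List.cons_prefix_cons, ih]

/-- The tree automorphism that rotates the `k`-th letter by `c(k)`. -/
def rotateAut (hm : 2 ≤ m) (c : ℕ → ZMod m) : TreeAut m :=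
  ⟨{ toFun := rotateFun c
     invFun := rotateFun (-c)
     left_inv := fun w => by rw [← rotateFun_add hm, neg_add_cancel, rotateFun_zero]
     right_inv := fun w => by rw [← rotateFun_add hm, add_neg_cancel, rotateFun_zero] },
   fun v w => rotateFun_prefix c v w⟩

theorem rotateAut_act_cons (hm : 2 ≤ m) (c : ℕ → ZMod m) (y : Fin m) (u : List (Fin m)) :
    (rotateAut hm c).act (y :: u) =
      (finRotate m ^ (c 0).val) y :: (rotateAut hm fun k => c (k + 1)).act u := rfl

theorem rotateAut_add (hm : 2 ≤ m) (c d : ℕ → ZMod m) :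
    rotateAut hm (c + d) = rotateAut hm c * rotateAut hm d := ext_act (rotateFun_add hm c d)

theorem rotateAut_zero (hm : 2 ≤ m) : rotateAut hm 0 = 1 := ext_act rotateFun_zero

theorem rotateAut_eq (hm : 2 ≤ m) (c : ℕ → ZMod m) :
    rotateAut hm c = sigma m ^ (c 0).val * diag (rotateAut hm fun k => c (k + 1)) := by
  refine ext_act fun w => ?_
  cases w with
  | nil => simp
  | cons y u => rw [act_mul, act_diag_cons, sigma_pow_act_cons, rotateAut_act_cons]

theorem rotateAut_mem (hm : 2 ≤ m) (c : ℕ → ZMod m) :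
    rotateAut hm c ∈ star (Subgroup.zpowers (sigma m)) := by
  intro n
  induction n generalizing c with
  | zero => exact ⟨1, one_mem _, fun w hw => by simp [List.length_eq_zero_iff.1 hw]⟩
  | succ n ih =>
    obtain ⟨k, hk, hck⟩ := ih fun k => c (k + 1)
    refine ⟨sigma m ^ (c 0).val * diag k, mul_mem (pow_mem (le_diagClosure _
      (Subgroup.mem_zpowers _)) _) (diag_mem_diagClosure hk), fun w hw => ?_⟩
    cases w with
    | nil => simp
    | cons y u =>
      rw [rotateAut_eq, act_mul, act_mul, act_diag_cons, act_diag_cons, hck u (by simpa using hw)]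

theorem eq_zero_of_rotateAut_eq_one (hm : 2 ≤ m) {c : ℕ → ZMod m} (h : rotateAut hm c = 1)
    (k : ℕ) : c k = 0 := by
  have : NeZero m := ⟨by omega⟩
  have hy (y : Fin m) (u : List (Fin m)) :=
    (rotateAut_act_cons hm c y u).symm.trans (congrArg (fun g => act g (y :: u)) h)
  induction k generalizing c with
  | zero =>
    have h1 : finRotate m ^ (c 0).val = 1 := Equiv.ext fun y => (List.cons.inj (hy y [])).1
    have h2 := orderOf_dvd_of_pow_eq_one h1
    rw [(isCycle_finRotate_of_le hm).orderOf, support_finRotate_of_le hm, Finset.card_univ,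
      Fintype.card_fin] at h2
    exact (ZMod.val_eq_zero _).1 (Nat.eq_zero_of_dvd_of_lt h2 (ZMod.val_lt _))
  | succ k ih =>
    have h1 : (rotateAut hm fun k => c (k + 1)) = 1 :=
      ext_act fun u => (List.cons.inj (hy ⟨0, by omega⟩ u)).2
    exact ih h1 fun _ _ => (rotateAut_act_cons hm _ _ _).symm.trans (by rw [h1])

/-- Every element of `⟨σ⟩*` rotates the letters of a word independently: splitting off the action on
the first letter leaves the diagonal image of another element, and so on. -/
theorem exists_rotateAut_eq (hm : m.Prime) {b : TreeAut m}
    (hb : b ∈ star (Subgroup.zpowers (sigma m))) : ∃ c, rotateAut hm.two_le c = b := by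
  have hS := isSaturated_star_sigma hm.two_le
  have : NeZero m := ⟨hm.ne_zero⟩
  have hσ : sigma m ∈ star (Subgroup.zpowers (sigma m)) := le_star _ (Subgroup.mem_zpowers _)
  have hdec : ∀ b : star (Subgroup.zpowers (sigma m)), ∃ t : ZMod m,
      ∃ d : star (Subgroup.zpowers (sigma m)), (b : TreeAut m) = sigma m ^ t.val * diag d := by
    rintro ⟨b, hb⟩
    obtain ⟨t, ht⟩ := hS.exists_zpow hm hb hσ (mem_levelStab_zero b) (mem_levelStab_zero _)
      (sigma_notMem_levelStab_one hm.two_le)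
    obtain ⟨d, hd, hdb⟩ := hS.exists_diag_eq hm.pos (mul_mem (inv_mem (zpow_mem hσ t)) hb) ht
    refine ⟨t, ⟨d, hd⟩, ?_⟩
    have hpow : sigma m ^ (t : ZMod m).val = sigma m ^ t := by
      rw [← zpow_natCast, ZMod.val_intCast]
      exact (zpow_eq_zpow_emod' t (sigma_pow_self hm.two_le)).symm
    rw [hpow, hdb, mul_inv_cancel_left]
  choose t d hd using hdec
  refine ⟨fun k => t (d^[k] ⟨b, hb⟩), ext_act fun w => ?_⟩
  change _ = act ((⟨b, hb⟩ : star (Subgroup.zpowers (sigma m))) : TreeAut m) w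
  generalize (⟨b, hb⟩ : star (Subgroup.zpowers (sigma m))) = b'
  induction w generalizing b' with
  | nil => simp
  | cons y u ih =>
    rw [rotateAut_act_cons, hd b', act_mul, act_diag_cons, sigma_pow_act_cons, ← ih (d b')]
    rfl

/-- The action of power series on `σ` identifies the additive group of `(ℤ/m)[[x]]` with `⟨σ⟩*`. -/
theorem exists_powerSeries_mulEquiv (hm : m.Prime) :
    ∃ e : Multiplicative (PowerSeries (ZMod m)) ≃* star (Subgroup.zpowers (sigma m)),
      (e (Multiplicative.ofAdd 1) : TreeAut m) = sigma m ∧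
      ∀ f : PowerSeries (ZMod m), (e (Multiplicative.ofAdd (PowerSeries.X * f)) : TreeAut m) =
        diag (e (Multiplicative.ofAdd f) : TreeAut m) := by
  have h2 := hm.two_le
  have : Fact (1 < m) := ⟨h2⟩
  let φ : Multiplicative (PowerSeries (ZMod m)) →* star (Subgroup.zpowers (sigma m)) :=
    MonoidHom.mk' (fun f => ⟨rotateAut h2 fun k => PowerSeries.coeff k f.toAdd,
      rotateAut_mem h2 _⟩) fun f g => Subtype.ext (rotateAut_add h2 _ _)
  have hφ : ∀ f : PowerSeries (ZMod m), (φ (Multiplicative.ofAdd f) : TreeAut m) =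
      rotateAut h2 fun k => PowerSeries.coeff k f := fun _ => rfl
  have hbij : Function.Bijective φ := by
    constructor
    · rw [injective_iff_map_eq_one]
      intro f hf
      have h : f.toAdd = 0 := PowerSeries.ext fun k =>
        eq_zero_of_rotateAut_eq_one h2 (congrArg Subtype.val hf) k
      exact Multiplicative.toAdd.injective h
    · rintro ⟨b, hb⟩
      obtain ⟨c, rfl⟩ := exists_rotateAut_eq hm hb
      exact ⟨Multiplicative.ofAdd (PowerSeries.mk c), Subtype.ext (by simp [hφ])⟩
  refine ⟨MulEquiv.ofBijective φ hbij, ?_, fun f => ?_⟩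
  · rw [MulEquiv.ofBijective_apply, hφ, rotateAut_eq]
    have : (fun k => PowerSeries.coeff (k + 1) (1 : PowerSeries (ZMod m))) = 0 :=
      funext fun k => by simp [PowerSeries.coeff_one]
    rw [this, rotateAut_zero, PowerSeries.coeff_zero_one, ZMod.val_one, pow_one]
    exact (congrArg _ (map_one (diagHom m))).trans (mul_one _)
  · rw [MulEquiv.ofBijective_apply, MulEquiv.ofBijective_apply, hφ, hφ, rotateAut_eq]
    simp [PowerSeries.coeff_succ_X_mul]

/-! ### Abelian transitive state-closed groups -/

namespace IsSaturated

variable {B : Subgroup (TreeAut m)}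

/-- An element `β` of depth `0` with `β ^ m` of depth `j ≥ 1` yields the sequence
`(β^(k % j)) ^ (m ^ (k / j))` of elements of depth `k`. -/
theorem depth_pow_mod (hB : IsSaturated B) (hm : m.Prime) {β : TreeAut m} (hβ : β ∈ B)
    (hβ1 : β ∉ levelStab m 1) {j : ℕ} (hj : β ^ m ∈ levelStab m j)
    (hj' : β ^ m ∉ levelStab m (j + 1)) (k : ℕ) :
    (diag^[k % j] β) ^ m ^ (k / j) ∈ levelStab m k ∧
      (diag^[k % j] β) ^ m ^ (k / j) ∉ levelStab m (k + 1) := by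
  have H : ∀ r q, (diag^[r] β) ^ m ^ q ∈ levelStab m (r + j * q) ∧
      (diag^[r] β) ^ m ^ q ∉ levelStab m (r + j * q + 1) := by
    intro r q
    induction q with
    | zero => simpa using diag_iterate_depth hm.pos hβ1 r
    | succ q ih =>
      rw [pow_succ, pow_mul, Nat.mul_succ, ← Nat.add_assoc]
      exact hB.pow_depth hm hβ hβ1 hj hj' (pow_mem (hB.diag_iterate_mem hβ r) _) ih.1 ih.2
  simpa only [Nat.mod_add_div] using H (k % j) (k / j)

theorem topologicallyFG (hB : IsSaturated B) (hm : m.Prime) {β : TreeAut m} (hβ : β ∈ B)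
    (hβ1 : β ∉ levelStab m 1) {j : ℕ} (hj1 : 1 ≤ j) (hj : β ^ m ∈ levelStab m j)
    (hj' : β ^ m ∉ levelStab m (j + 1)) : TopologicallyFG B := by
  classical
  refine ⟨(Finset.range j).image fun i => diag^[i] β, hB.treeClosure_eq_of_depth hm ?_ fun k => ?_⟩
  · refine (Subgroup.closure_le _).2 ?_
    rw [Finset.coe_image]
    rintro _ ⟨i, _, rfl⟩
    exact hB.diag_iterate_mem hβ i
  · refine ⟨_, pow_mem (Subgroup.subset_closure ?_) _, hB.depth_pow_mod hm hβ hβ1 hj hj' k⟩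
    exact Finset.mem_coe.2 (Finset.mem_image_of_mem _ (Finset.mem_range.2 (Nat.mod_lt k hj1)))

theorem conj_of_pow_depth {C : Subgroup (TreeAut m)} (hB : IsSaturated B) (hC : IsSaturated C)
    (hm : m.Prime) {β γ : TreeAut m} (hβ : β ∈ B) (hβ1 : β ∉ levelStab m 1) (hγ : γ ∈ C)
    (hγ1 : γ ∉ levelStab m 1) {j : ℕ} (hj1 : 1 ≤ j) (hj : β ^ m ∈ levelStab m j)
    (hj' : β ^ m ∉ levelStab m (j + 1)) (hγj : γ ^ m ∈ levelStab m j)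
    (hγj' : γ ^ m ∉ levelStab m (j + 1)) : Conj B C := by
  refine hB.conj_of_depth hC hm (β := fun k => (diag^[k % j] β) ^ m ^ (k / j))
    (γ := fun k => (diag^[k % j] γ) ^ m ^ (k / j))
    (fun k => pow_mem (hB.diag_iterate_mem hβ _) _) (hB.depth_pow_mod hm hβ hβ1 hj hj')
    (fun k => pow_mem (hC.diag_iterate_mem hγ _) _) (hC.depth_pow_mod hm hγ hγ1 hγj hγj')
    fun k => ?_
  refine Subgroup.subset_closure ⟨k + j, by omega, ?_⟩
  simp only [Prod.pow_mk, Nat.add_mod_right, Nat.add_div_right k hj1, ← pow_mul, ← pow_succ]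

theorem conj_of_pow_eq_one {C : Subgroup (TreeAut m)} (hB : IsSaturated B) (hC : IsSaturated C)
    (hm : m.Prime) {β γ : TreeAut m} (hβ : β ∈ B) (hβ1 : β ∉ levelStab m 1) (hγ : γ ∈ C)
    (hγ1 : γ ∉ levelStab m 1) (h : β ^ m = 1) (h' : γ ^ m = 1) : Conj B C := by
  refine hB.conj_of_depth hC hm (β := fun k => diag^[k] β) (γ := fun k => diag^[k] γ)
    (hB.diag_iterate_mem hβ) (diag_iterate_depth hm.pos hβ1)
    (hC.diag_iterate_mem hγ) (diag_iterate_depth hm.pos hγ1) fun k => ?_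
  have h1 : diag^[k] (1 : TreeAut m) = 1 := map_one (diagIterHom m k)
  rw [Prod.pow_mk, ← diag_iterate_pow, ← diag_iterate_pow, h, h', h1]
  exact one_mem _

end IsSaturated

theorem exponent_eq_of_forall_pow_eq_one (hm : m.Prime) {G : Subgroup (TreeAut m)}
    (htr : Transitive G) (h : ∀ g ∈ G, g ^ m = 1) : Monoid.exponent G = m := by
  have hdvd : Monoid.exponent G ∣ m :=
    Monoid.exponent_dvd_of_forall_pow_eq_one fun g => Subtype.ext (h g g.2)
  refine ((Nat.dvd_prime hm).1 hdvd).resolve_left fun h1 => ?_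
  obtain ⟨g, hg, hg1⟩ := IsSaturated.exists_notMem_levelStab_one htr hm
  have := Monoid.pow_exponent_eq_one (⟨g, hg⟩ : G)
  rw [h1, pow_one] at this
  have hg' : g = 1 := congrArg Subtype.val this
  exact hg1 (hg' ▸ one_mem _)

end TreeAut

theorem theorem9 (m : ℕ) (hm : m.Prime) (A : Subgroup (TreeAut m))
    (hab : ∀ a ∈ A, ∀ b ∈ A, a * b = b * a)
    (htr : TreeAut.Transitive A) (hsc : TreeAut.StateClosed A) :
    -- the torsion subgroup of `A` is nontrivial
    ((∃ a ∈ A, a ≠ 1 ∧ IsOfFinOrder a) →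
      (∀ a ∈ TreeAut.star A, IsOfFinOrder a) ∧
      Monoid.exponent A = m ∧
      Monoid.exponent (TreeAut.star A) = m ∧
      TreeAut.Conj (TreeAut.star A)
        (TreeAut.star (Subgroup.zpowers (TreeAut.sigma m))) ∧
      ∃ e : Multiplicative (PowerSeries (ZMod m)) ≃*
          TreeAut.star (Subgroup.zpowers (TreeAut.sigma m)),
        (e (Multiplicative.ofAdd 1) : TreeAut m) = TreeAut.sigma m ∧
        ∀ f : PowerSeries (ZMod m),
          (e (Multiplicative.ofAdd (PowerSeries.X * f)) : TreeAut m) =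
            TreeAut.diag (e (Multiplicative.ofAdd f) : TreeAut m)) ∧
    -- `A` is torsion-free
    ((∀ a ∈ A, IsOfFinOrder a → a = 1) →
      (∀ a ∈ TreeAut.star A, IsOfFinOrder a → a = 1) ∧
      (∀ β ∈ A, β ∉ TreeAut.levelStab m 1 →
        TreeAut.star A = TreeAut.star (Subgroup.zpowers β)) ∧
      TreeAut.TopologicallyFG (TreeAut.star A) ∧
      ∃ j : ℕ, 1 ≤ j ∧
        TreeAut.Conj (TreeAut.star A) (TreeAut.treeClosure (TreeAut.groupD m j))) := by
  open TreeAut in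
  have hB := isSaturated_star hab htr hsc
  have hAB := le_star A
  obtain ⟨β, hβ, hβ1⟩ := IsSaturated.exists_notMem_levelStab_one htr hm
  constructor
  · rintro ⟨a, ha, ha1, hfin⟩
    have hpow : β ^ m = 1 := by
      by_contra h
      exact ha1 (hB.eq_one_of_isOfFinOrder hm (hAB hβ) hβ1 h (hAB ha) hfin)
    have hexp : ∀ b ∈ star A, b ^ m = 1 := fun b hb => hB.pow_eq_one hm (hAB hβ) hβ1 hpow hb
    exact ⟨fun b hb => isOfFinOrder_iff_pow_eq_one.2 ⟨m, hm.pos, hexp b hb⟩,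
      exponent_eq_of_forall_pow_eq_one hm htr fun g hg => hexp g (hAB hg),
      exponent_eq_of_forall_pow_eq_one hm hB.trans hexp,
      hB.conj_of_pow_eq_one (isSaturated_star_sigma hm.two_le) hm (hAB hβ) hβ1
        (le_star _ (Subgroup.mem_zpowers _)) (sigma_notMem_levelStab_one hm.two_le) hpow
        (sigma_pow_self hm.two_le),
      exists_powerSeries_mulEquiv hm⟩
  · intro htf
    have hpow : β ^ m ≠ 1 := fun h => by
      rw [htf β hβ (isOfFinOrder_iff_pow_eq_one.2 ⟨m, hm.pos, h⟩)] at hβ1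
      exact hβ1 (one_mem _)
    obtain ⟨j, hj, hj'⟩ := exists_mem_levelStab_notMem_succ hpow
    have hj1 : 1 ≤ j := by
      by_contra! h
      obtain rfl : j = 0 := by omega
      exact hj' (hB.pow_mem_levelStab_one hm.pos (hAB hβ))
    have hα1 : addingMachine m j ∉ levelStab m 1 := by
      rw [← levelOnePerm_eq_one, levelOnePerm_addingMachine]
      exact finRotate_ne_one hm.two_le
    have hα := IsSaturated.diag_iterate_depth hm.pos hα1 j
    rw [← addAut_eq_diag, ← addingMachine_pow hm.pos hj1] at hα
    exact ⟨fun a ha => hB.eq_one_of_isOfFinOrder hm (hAB hβ) hβ1 hpow ha,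
      fun γ hγ hγ1 => (hB.star_zpowers_eq hm (hAB hγ) hγ1).symm,
      hB.topologicallyFG hm (hAB hβ) hβ1 hj1 hj hj',
      j, hj1, hB.conj_of_pow_depth (isSaturated_treeClosure_groupD hm.two_le hj1) hm (hAB hβ) hβ1
        (le_treeClosure _ (Subgroup.subset_closure ⟨[], (state_nil _).symm⟩)) hα1 hj1 hj hj'
        hα.1 hα.2⟩
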